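/- Let $n\ge 1$, $L>0$, and let $\Lambda\subset\mathbb{R}^{n+1}$ be an infinite pipe that is $L$-periodic in the direction of the last coordinate $z=x_{n+1}$: $\Lambda$ is open, $\Lambda+L\mathbf e_z=\Lambda$ (where $\mathbf e_z$ is the unit vector in the $z$-direction), its boundary $S=\partial\Lambda$ is of class $C^2$, every cross section $\Sigma_z=\{(x,z)\in\Lambda\}$, $z\in\mathbb{R}$, is nonempty and connected, and the cell $\Lambda_{0,L}=\{(x,z)\in\Lambda: 0<z<L\}$ is bounded. Let $L^2_*(\Lambda)$ be the Hilbert space of vector fields $\phi:\Lambda\to\mathbb{R}^{n+1}$ that are $L$-periodic in $z$ and square integrable on $\Lambda_{0,L}$, with scalar product $(\phi,\psi)=\int_{\Lambda_{0,L}}\phi\cdot\psi$ and norm $\|\cdot\|$. Let $H^1_{0,*}(\Lambda)$ be the space of $\phi\in L^2_*(\Lambda)$ whose weak gradient is $L$-periodic in $z$ and square integrable on $\Lambda_{0,L}$, and whose trace on $S$ is zero. Let $\mathcal V(\Lambda)$ be the space of smooth divergence-free vector fields that are $L$-periodic in $z$ and have support contained in $\Lambda$; let $\mathbb H(\Lambda)$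 be the closure of $\mathcal V(\Lambda)$ in $L^2_*(\Lambda)$, let $\mathbb V(\Lambda)$ be the closure of $\mathcal V(\Lambda)$ in $H^1_{0,*}(\Lambda)$ (for the $H^1(\Lambda_{0,L})$ norm), and let $\mathbb P:L^2_*(\Lambda)\to\mathbb H(\Lambda)$ be the orthogonal projection (Leray projection). Then $$\mathbb P\mathbf e_z\neq 0,\qquad \mathbb P\mathbf e_z\notin\mathbb V(\Lambda),$$ and indeed $\mathbb P\mathbf e_z\notin H^1_{0,*}(\Lambda)$. The same holds for $\mathbf e=\mathbb P\mathbf e_z/\|\mathbb P\mathbf e_z\|$: $\mathbf e\neq0$, $\mathbf e\notin\mathbb V(\Lambda)$ and $\mathbf e\notin H^1_{0,*}(\Lambda)$. -/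

import Mathlib

open MeasureTheory
open scoped ContDiff

noncomputable section

/-- Points `(x₁, …, xₙ, z)` of `ℝⁿ⁺¹`; the axial coordinate `z` is the last one. -/
abbrev Space (n : ℕ) : Type := EuclideanSpace ℝ (Fin (n + 1))

/-- The unit vector in the `z`-direction. -/
def axis (n : ℕ) : Space n := EuclideanSpace.single (Fin.last n) 1

/-- The open cell `0 < z < L` of a subset of `ℝⁿ⁺¹`. -/
def cellOf {n : ℕ} (L : ℝ) (Λ : Set (Space n)) : Set (Space n) :=
  {x ∈ Λ | 0 < x (Fin.last n) ∧ x (Fin.last n) < L}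

/-- The boundary of `Λ` is of class `C²`: near each boundary point, `Λ` is the sublevel set
`{ρ < 0}` of a `C²` function without critical points. -/
def HasC2Boundary {n : ℕ} (Λ : Set (Space n)) : Prop :=
  ∀ p ∈ frontier Λ, ∃ U : Set (Space n), IsOpen U ∧ p ∈ U ∧
    ∃ ρ : Space n → ℝ, ContDiffOn ℝ 2 ρ U ∧ (∀ x ∈ U, fderiv ℝ ρ x ≠ 0) ∧
      Λ ∩ U = {x ∈ U | ρ x < 0}

/-- An infinite pipe in `ℝⁿ⁺¹`, `L`-periodic in the `z`-direction. -/
structure Pipe (n : ℕ) where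
  L : ℝ
  L_pos : 0 < L
  carrier : Set (Space n)
  isOpen : IsOpen carrier
  periodic : ∀ x, x + L • axis n ∈ carrier ↔ x ∈ carrier
  /-- Every cross section is nonempty and connected. -/
  section_connected : ∀ z : ℝ, IsConnected {x ∈ carrier | x (Fin.last n) = z}
  cell_bounded : Bornology.IsBounded (cellOf L carrier)
  boundary : HasC2Boundary carrier

namespace Pipe

variable {n : ℕ} (P : Pipe n)

/-- The cell `Λ_{0,L}`. -/
def cell : Set (Space n) := cellOf P.L P.carrier

/-- Lebesgue measure on the cell. -/
def cellMeasure : Measure (Space n) := volume.restrict P.cell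

instance : IsFiniteMeasure P.cellMeasure :=
  isFiniteMeasure_restrict.2 P.cell_bounded.measure_lt_top.ne

/-- The space of `L`-periodic, locally square integrable vector fields on the pipe, with the
scalar product `∫_{Λ_{0,L}} φ ⬝ ψ`. A periodic field is determined (a.e.) by its restriction to the
cell, which is an arbitrary element of `L²(Λ_{0,L})`; it is represented by this restriction. -/
abbrev L2 : Type := Lp (Space n) 2 P.cellMeasure

/-- The constant field `e_z`, as an element of `L²`. -/
def ez : P.L2 := (memLp_const (axis n)).toLp (fun _ => axis n)

/-- Divergence of a vector field. -/
def div (φ : Space n → Space n) (x : Space n) : ℝ :=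
  ∑ i, (fderiv ℝ φ x (EuclideanSpace.single i 1)) i

/-- The smooth, `L`-periodic, divergence free fields with support contained in the pipe
(each of them is extended by zero to the whole space). -/
structure IsSolenoidalTest (φ : Space n → Space n) : Prop where
  smooth : ContDiff ℝ ∞ φ
  periodic : ∀ x, φ (x + P.L • axis n) = φ x
  support : tsupport φ ⊆ P.carrier
  div_eq_zero : ∀ x, div φ x = 0

/-- The space `𝒱` of solenoidal test fields, as a subspace of `L²`. -/
def testSpace : Submodule ℝ P.L2 where
  carrier := {u | ∃ φ, P.IsSolenoidalTest φ ∧ u =ᵐ[P.cellMeasure] φ}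
  zero_mem' := by
    refine ⟨fun _ => 0, ⟨contDiff_const, fun _ => rfl, ?_, fun x => ?_⟩, Lp.coeFn_zero _ _ _⟩
    · have : tsupport (fun _ : Space n => (0 : Space n)) = ∅ := by
        rw [tsupport_eq_empty_iff]; rfl
      simp [this]
    · simp [div]
  add_mem' := by
    rintro u v ⟨φ, hφ, hu⟩ ⟨ψ, hψ, hv⟩
    refine ⟨φ + ψ, ⟨hφ.smooth.add hψ.smooth, fun x => ?_, ?_, fun x => ?_⟩, ?_⟩
    · simp [hφ.periodic x, hψ.periodic x]
    · exact (tsupport_add φ ψ).trans (Set.union_subset hφ.support hψ.support)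
    · have h1 : DifferentiableAt ℝ φ x := hφ.smooth.differentiable (by simp) x
      have h2 : DifferentiableAt ℝ ψ x := hψ.smooth.differentiable (by simp) x
      have h3 := hφ.div_eq_zero x
      have h4 := hψ.div_eq_zero x
      simp only [div] at h3 h4 ⊢
      simp [fderiv_add h1 h2, Finset.sum_add_distrib, h3, h4]
    · exact (Lp.coeFn_add u v).trans (hu.add hv)
  smul_mem' := by
    rintro c u ⟨φ, hφ, hu⟩
    refine ⟨c • φ, ⟨hφ.smooth.const_smul c, fun x => ?_, ?_, fun x => ?_⟩, ?_⟩
    · simp [hφ.periodic x]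
    · exact (closure_mono (Function.support_const_smul_subset c φ)).trans hφ.support
    · have h1 : DifferentiableAt ℝ φ x := hφ.smooth.differentiable (by simp) x
      have h3 := hφ.div_eq_zero x
      simp only [div] at h3 ⊢
      simp [fderiv_const_smul h1 c, ← Finset.mul_sum, h3]
    · exact (Lp.coeFn_smul c u).trans (hu.const_smul c)

/-- The space `ℍ`: the closure of `𝒱` in `L²`. -/
def H : Submodule ℝ P.L2 := P.testSpace.topologicalClosure

instance : CompleteSpace P.H :=
  inferInstanceAs (CompleteSpace P.testSpace.topologicalClosure)

/-- The Leray projection: the orthogonal projection of `L²` onto `ℍ`. -/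
def leray (u : P.L2) : P.L2 := P.H.starProjection u

/-- `U` is a field in `H¹`: an `L`-periodic field on the pipe, square integrable on the cell,
with `L`-periodic weak gradient `G` on the pipe, also square integrable on the cell. -/
structure IsH1 (U : Space n → Space n) (G : Space n → Space n →L[ℝ] Space n) : Prop where
  periodic : ∀ x ∈ P.carrier, U (x + P.L • axis n) = U x
  grad_periodic : ∀ x ∈ P.carrier, G (x + P.L • axis n) = G x
  memLp : MemLp U 2 P.cellMeasure
  grad_memLp : MemLp G 2 P.cellMeasure
  weak_grad : ∀ ψ : Space n → ℝ, ContDiff ℝ ∞ ψ → HasCompactSupport ψ → tsupport ψ ⊆ P.carrier →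
    ∀ w : Space n,
      (∫ x in P.carrier, (fderiv ℝ ψ x w) • U x) = -(∫ x in P.carrier, ψ x • G x w)

/-- The `H¹` field `U` with weak gradient `G` has zero trace on the lateral boundary: the
boundary term in Green's formula vanishes for every smooth compactly supported function
on `ℝⁿ⁺¹`, in particular those that do not vanish on the boundary. -/
def HasZeroTrace (U : Space n → Space n) (G : Space n → Space n →L[ℝ] Space n) : Prop :=
  ∀ ψ : Space n → ℝ, ContDiff ℝ ∞ ψ → HasCompactSupport ψ → ∀ w : Space n,
    (∫ x in P.carrier, (fderiv ℝ ψ x w) • U x) = -(∫ x in P.carrier, ψ x • G x w)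

/-- The space `H¹₀` of periodic `H¹` fields with zero trace on the lateral boundary. -/
def H10 : Set P.L2 :=
  {u | ∃ U G, P.IsH1 U G ∧ P.HasZeroTrace U G ∧ u =ᵐ[P.cellMeasure] U}

/-- The space `𝕍`: the closure of `𝒱` in `H¹₀` with respect to the `H¹` norm. -/
def V : Set P.L2 :=
  {u | ∃ U G, P.IsH1 U G ∧ P.HasZeroTrace U G ∧ u =ᵐ[P.cellMeasure] U ∧
    ∀ ε > 0, ∃ φ, P.IsSolenoidalTest φ ∧
      eLpNorm (fun x => U x - φ x) 2 P.cellMeasure < ε ∧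
      eLpNorm (fun x => G x - fderiv ℝ φ x) 2 P.cellMeasure < ε}

/-- The normalized field `e = ℙe_z / ‖ℙe_z‖`. -/
def e : P.L2 := ‖P.leray P.ez‖⁻¹ • P.leray P.ez

end Pipe

end

/-! Two facts about `u = ℙe_z` are proved: it pairs nontrivially with some test field, and a
zero-trace representative would force it to vanish.

Nonvanishing (`exists_test_flux_ne_zero`). The pipe is connected, so a bump `b` at a point `p` can
be transported inside it to `p + L e_z`; the difference of the two bumps is the divergence of a
field `φ` compactly supported in `Λ`. Periodization makes the two bumps cancel, so the periodized
`φ` is a solenoidal test field, and integrating by parts against `z` gives flux `∫ φ·e_z = L ∫ b >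
0`. Since `ℙ` is self-adjoint and fixes `ℍ`, this nonzero number is also a pairing with `ℙe_z`.

No zero-trace representative (`leray_ez_notMem_H10`). Extended by zero, `u` is weakly divergence
free on all of space, because `𝒱` is orthogonal to periodized gradients. Inside `Λ` it is weakly
curl free, because `∂ᵢψ eⱼ - ∂ⱼψ eᵢ` is a test field with zero mean. Zero trace means that
differentiating the zero extension creates no boundary term, so it is curl free across `S` as well.
Its components are then weakly harmonic on the whole space, periodic in `z` and zero outside a
bounded cylinder. Mollification and the maximum principle (`ae_eq_zero_of_div_curl_free`,
`nonpos_of_harmonic_periodic`) give `u = 0`, a contradiction. The hypothesis `1 ≤ n` provides a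
transverse direction in which the cylinder is bounded. -/

noncomputable section

/-! ### Axial translations, periodization and unfolding of integrals -/

/-- Translation by `k` periods in the axial direction. -/
def shift {n : ℕ} (L : ℝ) (k : ℤ) (x : Space n) : Space n := x + ((k : ℝ) * L) • axis n

/-- The periodization of a function in the axial direction. -/
def periodize {n : ℕ} {F : Type*} [AddCommMonoid F] [TopologicalSpace F] (L : ℝ)
    (f : Space n → F) (x : Space n) : F :=
  ∑' k : ℤ, f (shift L k x)

section Shift

variable {n : ℕ} {L : ℝ} {F : Type*} [NormedAddCommGroup F]

@[simp] lemma axis_last : axis n (Fin.last n) = 1 := by simp [axis]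

lemma axis_of_ne {i : Fin (n + 1)} (hi : i ≠ Fin.last n) : axis n i = 0 := by simp [axis, hi]

@[simp] lemma shift_last (k : ℤ) (x : Space n) :
    shift L k x (Fin.last n) = x (Fin.last n) + k * L := by
  simp [shift]

lemma shift_of_ne (k : ℤ) (x : Space n) {i : Fin (n + 1)} (hi : i ≠ Fin.last n) :
    shift L k x i = x i := by
  simp [shift, axis_of_ne hi]

lemma shift_shift (k l : ℤ) (x : Space n) : shift L k (shift L l x) = shift L (l + k) x := by
  simp only [shift, add_assoc, ← add_smul, Int.cast_add, add_mul]

lemma add_period (x : Space n) : x + L • axis n = shift L 1 x := by simp [shift]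

@[simp] lemma shift_zero (x : Space n) : shift L 0 x = x := by simp [shift]

lemma eq_of_periodic {α : Type*} {f : Space n → α} (hf : ∀ x, f (x + L • axis n) = f x)
    (k : ℤ) (x : Space n) : f (shift L k x) = f x := by
  induction k using Int.induction_on with
  | zero => simp
  | succ k ih => rw [← ih, ← hf (shift L k x), add_period, shift_shift]
  | pred k ih => rw [← ih, ← hf (shift L _ x), add_period, shift_shift]; congr 2; ring

lemma hasFDerivAt_comp_shift [NormedSpace ℝ F] {f : Space n → F} (hf : Differentiable ℝ f) (k : ℤ) (x : Space n) :
    HasFDerivAt (fun y => f (shift L k y)) (fderiv ℝ f (shift L k x)) x := by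
  simpa [shift] using (hasFDerivAt_comp_add_right (((k : ℝ) * L) • axis n)).2
    (hf (shift L k x)).hasFDerivAt

lemma contDiff_shift (k : ℤ) : ContDiff ℝ ∞ (shift L k : Space n → Space n) :=
  contDiff_id.add contDiff_const

lemma continuous_shift (k : ℤ) : Continuous (shift L k : Space n → Space n) :=
  (contDiff_shift k).continuous

lemma measurePreserving_shift (k : ℤ) :
    MeasurePreserving (shift L k : Space n → Space n) volume volume :=
  measurePreserving_add_right _ _

lemma measurableEmbedding_shift (k : ℤ) :
    MeasurableEmbedding (shift L k : Space n → Space n) :=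
  measurableEmbedding_addRight _

/-- The half-open slab `kL < z ≤ (k + 1)L`. -/
def slab (n : ℕ) (L : ℝ) (k : ℤ) : Set (Space n) :=
  {x | k * L < x (Fin.last n) ∧ x (Fin.last n) ≤ (k + 1) * L}

lemma measurableSet_slab (k : ℤ) : MeasurableSet (slab n L k) := by
  have h : Measurable fun x : Space n => x (Fin.last n) := by fun_prop
  exact (measurableSet_lt measurable_const h).inter (measurableSet_le h measurable_const)

lemma preimage_shift_slab (k l : ℤ) : shift L k ⁻¹' slab n L (l + k) = slab n L l := by
  ext x
  simp only [slab, Set.mem_preimage, Set.mem_ofPred_eq, shift_last]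
  push_cast
  constructor <;> rintro ⟨h1, h2⟩ <;> constructor <;> linarith

lemma exists_mem_slab (hL : 0 < L) (x : Space n) : ∃ k : ℤ, x ∈ slab n L k := by
  obtain ⟨k, hk, -⟩ := existsUnique_add_zsmul_mem_Ioc hL (x (Fin.last n)) 0
  refine ⟨-k, ?_⟩
  simp only [Set.mem_Ioc, zsmul_eq_mul, zero_add] at hk
  simp only [slab, Set.mem_ofPred_eq]
  push_cast
  constructor <;> linarith

lemma iUnion_slab (hL : 0 < L) : ⋃ k, slab n L k = Set.univ :=
  Set.eq_univ_of_forall fun x => Set.mem_iUnion.2 (exists_mem_slab hL x)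

lemma pairwise_disjoint_slab (hL : 0 < L) : Pairwise (Function.onFun Disjoint (slab n L)) := by
  intro k l hkl
  refine Set.disjoint_left.2 fun x hk hl => hkl ?_
  simp only [slab, Set.mem_ofPred_eq] at hk hl
  have h1 : (k : ℝ) < l + 1 := lt_of_mul_lt_mul_right (hk.1.trans_le hl.2) hL.le
  have h2 : (l : ℝ) < k + 1 := lt_of_mul_lt_mul_right (hl.1.trans_le hk.2) hL.le
  have h3 : k < l + 1 := by exact_mod_cast h1
  have h4 : l < k + 1 := by exact_mod_cast h2
  omega

/-- Local finiteness: if `|z| ≤ M` on the support, then `|z + kL| ≤ M` and `|z| < R` force `|k| ≤ (M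
+ R) / L`, so one finite set serves all such points. -/
lemma exists_finset_shift_eq_zero {F : Type*} [Zero F] (hL : 0 < L) {f : Space n → F}
    (hf : HasCompactSupport f) (R : ℝ) : ∃ K : Finset ℤ, ∀ y : Space n, |y (Fin.last n)| < R → ∀ k ∉ K,
      f (shift L k y) = 0 := by
  obtain ⟨M, hM⟩ := hf.isCompact.bddAbove_image
    (f := fun x : Space n => |x (Fin.last n)|) (by fun_prop)
  refine ⟨Finset.Icc (-⌈(M + R) / L⌉) ⌈(M + R) / L⌉, fun y hy k hk => ?_⟩
  by_contra h
  refine hk ?_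
  have h1 : |y (Fin.last n) + k * L| ≤ M := by
    have := hM (Set.mem_image_of_mem _ (subset_tsupport f h))
    simpa using this
  rw [abs_le] at h1
  rw [abs_lt] at hy
  have h2 := Int.le_ceil ((M + R) / L)
  have h3 : |(k : ℝ)| ≤ (M + R) / L := by
    rw [abs_le, le_div_iff₀ hL, ← neg_div, div_le_iff₀ hL]
    constructor <;> linarith
  rw [abs_le] at h3
  rw [Finset.mem_Icc]
  constructor
  · have : (-⌈(M + R) / L⌉ : ℝ) ≤ k := by linarith
    exact_mod_cast this
  · have : (k : ℝ) ≤ ⌈(M + R) / L⌉ := by linarith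
    exact_mod_cast this

/-- Near each point the series is a fixed finite sum, so smoothness and termwise differentiation
need no convergence estimates. -/
lemma periodize_eventuallyEq (hL : 0 < L) {f : Space n → F} (hf : HasCompactSupport f)
    (x : Space n) : ∃ K : Finset ℤ,
      (periodize L f =ᶠ[nhds x] fun y => ∑ k ∈ K, f (shift L k y)) ∧
      ∀ k ∉ K, ∀ᶠ y in nhds x, f (shift L k y) = 0 := by
  obtain ⟨K, hK⟩ := exists_finset_shift_eq_zero hL hf (|x (Fin.last n)| + 1)
  have h : ∀ᶠ y : Space n in nhds x, |y (Fin.last n)| < |x (Fin.last n)| + 1 := by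
    have hc : Continuous fun y : Space n => |y (Fin.last n)| := by fun_prop
    exact hc.continuousAt.eventually_lt continuousAt_const (by simp)
  refine ⟨K, ?_, fun k hk => h.mono fun y hy => hK y hy k hk⟩
  filter_upwards [h] with y hy
  exact tsum_eq_sum fun k hk => hK y hy k hk

lemma summable_shift (hL : 0 < L) {f : Space n → F} (hf : HasCompactSupport f) (x : Space n) :
    Summable fun k : ℤ => f (shift L k x) := by
  obtain ⟨K, -, hK⟩ := periodize_eventuallyEq hL hf x
  exact summable_of_ne_finset_zero fun k hk => (hK k hk).self_of_nhds

lemma contDiff_periodize [NormedSpace ℝ F] (hL : 0 < L) {f : Space n → F} (hf : HasCompactSupport f)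
    (hs : ContDiff ℝ ∞ f) : ContDiff ℝ ∞ (periodize L f) := by
  rw [contDiff_iff_contDiffAt]
  intro x
  obtain ⟨K, hK, -⟩ := periodize_eventuallyEq hL hf x
  refine ContDiffAt.congr_of_eventuallyEq ?_ hK
  exact (ContDiff.sum fun k _ => hs.comp (contDiff_shift k)).contDiffAt

lemma fderiv_periodize [NormedSpace ℝ F] (hL : 0 < L) {f : Space n → F} (hf : HasCompactSupport f)
    (hs : ContDiff ℝ ∞ f) (x : Space n) :
    fderiv ℝ (periodize L f) x = periodize L (fderiv ℝ f) x := by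
  obtain ⟨K, hK, hK'⟩ := periodize_eventuallyEq hL hf x
  have h1 : HasFDerivAt (fun y => ∑ k ∈ K, f (shift L k y))
      (∑ k ∈ K, fderiv ℝ f (shift L k x)) x :=
    HasFDerivAt.fun_sum fun k _ => hasFDerivAt_comp_shift (hs.differentiable (by simp)) k x
  rw [hK.fderiv_eq, h1.fderiv]
  symm
  refine tsum_eq_sum fun k hk => ?_
  rw [← (hasFDerivAt_comp_shift (hs.differentiable (by simp)) k x).fderiv]
  have h2 : (fun y => f (shift L k y)) =ᶠ[nhds x] fun _ => 0 := hK' k hk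
  rw [h2.fderiv_eq]
  simp

lemma periodize_periodic {f : Space n → F} (x : Space n) :
    periodize L f (x + L • axis n) = periodize L f x := by
  unfold periodize
  rw [← (Equiv.addLeft (1 : ℤ)).tsum_eq (fun k => f (shift L k x))]
  simp only [add_period, shift_shift, Equiv.coe_addLeft]

lemma tsupport_periodize (hL : 0 < L) {f : Space n → F} (hf : HasCompactSupport f)
    {x : Space n} (hx : x ∈ tsupport (periodize L f)) : ∃ k : ℤ, shift L k x ∈ tsupport f := by
  by_contra! h
  obtain ⟨K, hK, -⟩ := periodize_eventuallyEq hL hf x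
  refine (notMem_tsupport_iff_eventuallyEq.2 ?_) hx
  have h1 : ∀ k ∈ K, ∀ᶠ y in nhds x, f (shift L k y) = 0 := fun k _ =>
    (continuous_shift k).continuousAt.eventually (notMem_tsupport_iff_eventuallyEq.1 (h k))
  filter_upwards [hK, (Filter.eventually_all_finset K).2 h1] with y hy hy'
  rw [hy]
  exact Finset.sum_eq_zero hy'

/-- Unfolding: the integral of `⟪f, g⟫` over the whole space, `f` compactly supported and `g`
periodic, is the integral of the periodization of `f` against `g` over one period. -/
lemma integral_inner_eq_slab (hL : 0 < L) {f g : Space n → Space n} (hf : HasCompactSupport f)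
    (hg : ∀ x, g (x + L • axis n) = g x) (hfg : Integrable fun x => inner ℝ (f x) (g x)) :
    ∫ x, inner ℝ (f x) (g x) = ∫ x in slab n L 0, inner ℝ (periodize L f x) (g x) := by
  have h1 := hasSum_integral_iUnion (f := fun x => inner ℝ (f x) (g x)) (μ := volume)
    (fun k => measurableSet_slab k) (pairwise_disjoint_slab hL) hfg.integrableOn
  rw [iUnion_slab hL, setIntegral_univ] at h1
  have h2 : ∀ k : ℤ, ∫ x in slab n L k, inner ℝ (f x) (g x) =
      ∫ x in slab n L 0, inner ℝ (f (shift L k x)) (g x) := by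
    intro k
    rw [← (measurePreserving_shift (L := L) k).setIntegral_preimage_emb
      (measurableEmbedding_shift k), ← preimage_shift_slab k 0, zero_add]
    simp only [eq_of_periodic hg]
  -- On the slab `0 < z ≤ L`, so `L + 1` is a strict bound for `|z|`.
  obtain ⟨K, hK⟩ := exists_finset_shift_eq_zero hL hf (L + 1)
  have hK' : ∀ x ∈ slab n L 0, ∀ k ∉ K, f (shift L k x) = 0 := by
    intro x hx
    refine hK x ?_
    simp only [slab, Set.mem_ofPred_eq, Int.cast_zero, zero_mul, zero_add, one_mul] at hx
    rw [abs_lt]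
    constructor <;> linarith
  have h3 : ∀ k ∉ K, ∫ x in slab n L k, inner ℝ (f x) (g x) = 0 := by
    intro k hk
    rw [h2]
    refine setIntegral_eq_zero_of_forall_eq_zero fun x hx => ?_
    rw [hK' x hx k hk, inner_zero_left]
  have h4 : ∀ k, IntegrableOn (fun x => inner ℝ (f (shift L k x)) (g x)) (slab n L 0) := by
    intro k
    have := ((measurePreserving_shift (L := L) k).integrable_comp_emb
      (measurableEmbedding_shift k)).2 hfg
    simp only [Function.comp_def, eq_of_periodic hg] at this
    exact this.integrableOn
  rw [h1.unique (hasSum_sum_of_ne_finset_zero h3), Finset.sum_congr rfl fun k _ => h2 k,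
    ← integral_finsetSum K fun k _ => h4 k]
  refine setIntegral_congr_fun (measurableSet_slab 0) fun x hx => ?_
  simp only [periodize]
  rw [tsum_eq_sum (hK' x hx), sum_inner]

/-- A periodic function that is integrable over one slab is locally integrable. -/
lemma locallyIntegrable_of_periodic (hL : 0 < L) {g : Space n → F}
    (hg : ∀ x, g (x + L • axis n) = g x) (hi : IntegrableOn g (slab n L 0)) :
    LocallyIntegrable g := by
  have h1 : ∀ k : ℤ, IntegrableOn g (slab n L k) := by
    intro k
    have := ((measurePreserving_shift (L := L) k).integrableOn_comp_preimage
      (measurableEmbedding_shift k) (f := g) (s := slab n L (0 + k)))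
    rw [preimage_shift_slab] at this
    rw [zero_add] at this
    refine this.1 ?_
    simpa only [Function.comp_def, eq_of_periodic hg] using hi
  intro x
  obtain ⟨k, hk⟩ := exists_mem_slab hL x
  -- A point on the upper face `z = (k + 1)L` has no neighbourhood inside its own slab; the next
  -- slab supplies the rest.
  refine ⟨slab n L k ∪ slab n L (k + 1), ?_, (h1 k).union (h1 (k + 1))⟩
  have hc : Continuous fun y : Space n => y (Fin.last n) := by fun_prop
  have hk1 := hk.1
  have hk2 := hk.2
  have e1 : ∀ᶠ y : Space n in nhds x, k * L < y (Fin.last n) :=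
    continuousAt_const.eventually_lt hc.continuousAt hk1
  have e2 : ∀ᶠ y : Space n in nhds x, y (Fin.last n) < (k + 1 + 1) * L :=
    hc.continuousAt.eventually_lt continuousAt_const (by linarith)
  filter_upwards [e1, e2] with y h1 h2
  simp only [slab, Set.mem_union, Set.mem_ofPred_eq]
  push_cast
  rcases le_or_gt (y (Fin.last n)) ((k + 1) * L) with h | h
  · exact Or.inl ⟨h1, h⟩
  · exact Or.inr ⟨h, h2.le⟩

end Shift

/-! ### Divergence and integration by parts -/

section Divergence

variable {n : ℕ} {L : ℝ}

lemma sum_smul_single (b : Space n) : ∑ i, b i • EuclideanSpace.single i (1 : ℝ) = b := by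
  simpa using (EuclideanSpace.basisFun (Fin (n + 1)) ℝ).sum_repr b

lemma div_smul_const {c : Space n → ℝ} {x : Space n} (hc : DifferentiableAt ℝ c x) (b : Space n) :
    Pipe.div (fun y => c y • b) x = fderiv ℝ c x b := by
  conv_rhs => rw [← sum_smul_single b, map_sum]
  simp [Pipe.div, fderiv_smul_const hc, mul_comm]

lemma div_add {f g : Space n → Space n} {x : Space n} (hf : DifferentiableAt ℝ f x)
    (hg : DifferentiableAt ℝ g x) :
    Pipe.div (fun y => f y + g y) x = Pipe.div f x + Pipe.div g x := by
  simp [Pipe.div, fderiv_fun_add hf hg, Finset.sum_add_distrib]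

lemma div_fun_neg (f : Space n → Space n) (x : Space n) :
    Pipe.div (fun y => -f y) x = -Pipe.div f x := by
  simp [Pipe.div, fderiv_fun_neg]

/-- The trace of an endomorphism, as a continuous linear functional. -/
def traceCLM (n : ℕ) : (Space n →L[ℝ] Space n) →L[ℝ] ℝ :=
  ∑ i, (EuclideanSpace.proj i).comp
    (ContinuousLinearMap.apply ℝ (Space n) (EuclideanSpace.single i (1 : ℝ)))

lemma div_eq_traceCLM (f : Space n → Space n) (x : Space n) :
    Pipe.div f x = traceCLM n (fderiv ℝ f x) := by
  simp [Pipe.div, traceCLM]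

/-- The divergence is a continuous linear functional of the derivative, hence passes through the
sum. -/
lemma div_periodize (hL : 0 < L) {f : Space n → Space n} (hf : HasCompactSupport f)
    (hs : ContDiff ℝ ∞ f) (x : Space n) :
    Pipe.div (periodize L f) x = periodize L (Pipe.div f) x := by
  rw [div_eq_traceCLM, fderiv_periodize hL hf hs, periodize,
    (traceCLM n).map_tsum (summable_shift hL (hf.fderiv ℝ) x)]
  simp only [periodize, div_eq_traceCLM]

lemma integrable_mul_of_hasCompactSupport {f g : Space n → ℝ} (hf : Continuous f)
    (hg : Continuous g) (h : HasCompactSupport f ∨ HasCompactSupport g) :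
    Integrable fun x => f x * g x := by
  refine (hf.mul hg).integrable_of_hasCompactSupport ?_
  rcases h with h | h
  exacts [h.mul_right, h.mul_left]

/-- Integration by parts for the divergence. -/
lemma integral_fderiv_apply_eq_neg_integral_mul_div {ψ : Space n → ℝ} {φ : Space n → Space n}
    (hψ : ContDiff ℝ ∞ ψ) (hφ : ContDiff ℝ ∞ φ)
    (h : HasCompactSupport ψ ∨ HasCompactSupport φ) :
    ∫ x, fderiv ℝ ψ x (φ x) = -∫ x, ψ x * Pipe.div φ x := by
  have hψ' : ∀ v, Continuous fun x => fderiv ℝ ψ x v := fun v =>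
    (hψ.continuous_fderiv (by simp)).clm_apply continuous_const
  have hφ' : ∀ i, ContDiff ℝ ∞ fun x => φ x i := fun i => by fun_prop
  have hφ'' : ∀ (i : Fin (n + 1)) v, Continuous fun x => fderiv ℝ (fun y => φ y i) x v := fun i v =>
    ((hφ' i).continuous_fderiv (by simp)).clm_apply continuous_const
  have hsupp : ∀ i, HasCompactSupport φ → HasCompactSupport fun x => φ x i := fun i h =>
    h.comp_left (g := fun v : Space n => v i) rfl
  have e1 : ∀ x, fderiv ℝ ψ x (φ x) =
      ∑ i, fderiv ℝ ψ x (EuclideanSpace.single i 1) * φ x i := by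
    intro x
    conv_lhs => rw [← sum_smul_single (φ x), map_sum]
    simp [mul_comm]
  have e2 : ∀ x, ψ x * Pipe.div φ x =
      ∑ i, ψ x * fderiv ℝ (fun y => φ y i) x (EuclideanSpace.single i 1) := by
    intro x
    rw [Pipe.div, Finset.mul_sum]
    refine Finset.sum_congr rfl fun i _ => ?_
    congr 1
    have := ((EuclideanSpace.proj i : Space n →L[ℝ] ℝ).hasFDerivAt.comp x
      (hφ.differentiable (by simp) x).hasFDerivAt).fderiv
    have h' : ((EuclideanSpace.proj i : Space n →L[ℝ] ℝ) ∘ φ) = fun y => φ y i := rfl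
    rw [h'] at this
    rw [this]
    rfl
  have i1 : ∀ i : Fin (n + 1), Integrable fun x =>
      fderiv ℝ ψ x (EuclideanSpace.single i 1) * φ x i := fun i =>
    integrable_mul_of_hasCompactSupport (hψ' _) (hφ' i).continuous
      (h.imp (fun h => h.fderiv_apply ℝ _) (hsupp i))
  have i2 : ∀ i : Fin (n + 1), Integrable fun x =>
      ψ x * fderiv ℝ (fun y => φ y i) x (EuclideanSpace.single i 1) := fun i =>
    integrable_mul_of_hasCompactSupport hψ.continuous (hφ'' i _)
      (h.imp id fun h => (hsupp i h).fderiv_apply ℝ _)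
  simp only [e1, e2]
  rw [integral_finsetSum _ fun i _ => i1 i, integral_finsetSum _ fun i _ => i2 i,
    ← Finset.sum_neg_distrib]
  refine Finset.sum_congr rfl fun i _ => ?_
  rw [integral_mul_fderiv_eq_neg_fderiv_mul_of_integrable (i1 i) (i2 i)
    (integrable_mul_of_hasCompactSupport hψ.continuous (hφ' i).continuous (h.imp id (hsupp i)))
    (fun x _ => hψ.differentiable (by simp) x) (fun x _ => (hφ' i).differentiable (by simp) x),
    neg_neg]

end Divergence

/-! ### Transporting bumps by compactly supported fields -/

section Transport

variable {n : ℕ}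

/-- `f` is the divergence of a smooth field compactly supported in `Λ`. -/
def IsDivOf (Λ : Set (Space n)) (f : Space n → ℝ) : Prop :=
  ∃ φ : Space n → Space n, ContDiff ℝ ∞ φ ∧ HasCompactSupport φ ∧ tsupport φ ⊆ Λ ∧
    ∀ x, Pipe.div φ x = f x

lemma IsDivOf.add {Λ : Set (Space n)} {f g : Space n → ℝ} (hf : IsDivOf Λ f) (hg : IsDivOf Λ g) :
    IsDivOf Λ fun x => f x + g x := by
  obtain ⟨φ, hφ, hφ', hφ'', hφd⟩ := hf
  obtain ⟨ψ, hψ, hψ', hψ'', hψd⟩ := hg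
  refine ⟨fun x => φ x + ψ x, hφ.add hψ, hφ'.add hψ', ?_, fun x => ?_⟩
  · exact (tsupport_add φ ψ).trans (Set.union_subset hφ'' hψ'')
  · rw [div_add (hφ.differentiable (by simp) x) (hψ.differentiable (by simp) x), hφd, hψd]

lemma IsDivOf.neg {Λ : Set (Space n)} {f : Space n → ℝ} (hf : IsDivOf Λ f) :
    IsDivOf Λ fun x => -f x := by
  obtain ⟨φ, hφ, hφ', hφ'', hφd⟩ := hf
  have : tsupport (fun x => -φ x) = tsupport φ := tsupport_neg φ
  exact ⟨fun x => -φ x, hφ.neg, by rwa [HasCompactSupport, this], by rwa [this],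
    fun x => by rw [div_fun_neg, hφd]⟩

/-- Moving a bump along a straight segment produces a divergence. -/
lemma isDivOf_segment {Λ : Set (Space n)} {h : Space n → ℝ} (hs : ContDiff ℝ ∞ h)
    (hc : HasCompactSupport h) (a v : Space n)
    (hΛ : ∀ x ∈ tsupport h, ∀ t ∈ Set.Icc (0 : ℝ) 1, x + (a + t • v) ∈ Λ) :
    IsDivOf Λ fun x => h (x - a) - h (x - (a + v)) := by
  -- The witness is the field `F v`, with `F` the average of `h` along the segment: its divergence
  -- is the derivative of `F` along `v`, which telescopes to the endpoint values.
  set F : Space n → ℝ := fun x => ∫ t in (0 : ℝ)..1, h (x - (a + t • v)) with hF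
  have hγ : Continuous fun t : ℝ => a + t • v := by fun_prop
  have hFs : ContDiff ℝ ∞ F := by
    -- `F` is the convolution of `h` with the uniform measure on the segment, so it inherits
    -- smoothness from `h`.
    let μ : Measure (Space n) :=
      (volume.restrict (Set.Ioc (0 : ℝ) 1)).map fun t : ℝ => a + t • v
    have : IsFiniteMeasure μ := Measure.isFiniteMeasure_map _ _
    have h1 := hc.contDiff_convolution_right (𝕜 := ℝ) (n := ⊤) (ContinuousLinearMap.lsmul ℝ ℝ)
      (f := fun _ => (1 : ℝ)) (μ := μ) (integrable_const _).locallyIntegrable hs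
    convert h1 using 1
    ext x
    rw [hF]
    simp only [convolution, ContinuousLinearMap.lsmul_apply, one_smul]
    rw [integral_map hγ.aemeasurable, intervalIntegral.integral_of_le zero_le_one]
    exact (hs.continuous.comp (by fun_prop)).aestronglyMeasurable
  have hFd : ∀ x, fderiv ℝ F x v = h (x - a) - h (x - (a + v)) := by
    intro x
    set g : ℝ → ℝ := fun t => h (x - (a + t • v)) with hg
    have hgc : Continuous g := hs.continuous.comp (by fun_prop)
    -- Moving `x` along `v` only shifts the interval of integration, so the fundamental theorem of
    -- calculus suffices.
    have h1 : ∀ s : ℝ, F (x + s • v) = (∫ t in (0 : ℝ)..(1 - s), g t) -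
        ∫ t in (0 : ℝ)..(0 - s), g t := by
      intro s
      rw [intervalIntegral.integral_interval_sub_left (hgc.intervalIntegrable _ _)
        (hgc.intervalIntegrable _ _), ← intervalIntegral.integral_comp_sub_right]
      refine intervalIntegral.integral_congr fun t _ => ?_
      simp only [hg]
      congr 1
      module
    have hG : ∀ u : ℝ, HasDerivAt (fun u => ∫ t in (0 : ℝ)..u, g t) (g u) u := fun u =>
      (hgc.integral_hasStrictDerivAt 0 u).hasDerivAt
    have h2 : ∀ c : ℝ, HasDerivAt (fun s : ℝ => c - s) (-1) 0 := fun c => by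
      simpa using (hasDerivAt_id (0 : ℝ)).const_sub c
    have h3 : HasDerivAt (fun s : ℝ => F (x + s • v)) (g 0 - g 1) 0 := by
      have h4 := (HasDerivAt.scomp (0 : ℝ) (hG (1 - 0)) (h2 1)).sub
        (HasDerivAt.scomp (0 : ℝ) (hG (0 - 0)) (h2 0))
      have e : (fun s : ℝ => F (x + s • v)) = (fun u => ∫ t in (0 : ℝ)..u, g t) ∘ (fun s => 1 - s) -
          (fun u => ∫ t in (0 : ℝ)..u, g t) ∘ (fun s => 0 - s) := by
        ext s
        rw [h1]
        rfl
      have e' : g 0 - g 1 = (-1 : ℝ) • g (1 - 0) - (-1 : ℝ) • g (0 - 0) := by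
        simp only [sub_zero, smul_eq_mul]
        ring
      rw [e, e']
      exact h4
    have h5 : HasLineDerivAt ℝ F (fderiv ℝ F x v) x v :=
      (hFs.differentiable (by simp) x).hasFDerivAt.hasLineDerivAt v
    have h6 := HasDerivAt.unique h5 h3
    simpa [hg] using h6
  -- The region swept by the support of `h` as it moves along the segment.
  let K : Set (Space n) :=
    (fun q : Space n × ℝ => q.1 + (a + q.2 • v)) '' (tsupport h ×ˢ Set.Icc (0 : ℝ) 1)
  have hK : IsCompact K := (hc.isCompact.prod isCompact_Icc).image (by fun_prop)
  have hKΛ : K ⊆ Λ := by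
    rintro _ ⟨⟨x, t⟩, ⟨hx, ht⟩, rfl⟩
    exact hΛ x hx t ht
  have hsub : Function.support (fun x => F x • v) ⊆ K := by
    intro x hx
    by_contra hxK
    refine hx ?_
    have : F x = 0 := by
      rw [hF]
      refine intervalIntegral.integral_zero_ae (Filter.Eventually.of_forall fun t ht => ?_)
      by_contra hne
      refine hxK ⟨(x - (a + t • v), t), ⟨subset_tsupport h hne, ?_⟩, by simp⟩
      rw [Set.uIoc_of_le zero_le_one] at ht
      exact Set.Ioc_subset_Icc_self ht
    simp [this]
  refine ⟨fun x => F x • v, hFs.smul contDiff_const,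
    HasCompactSupport.of_support_subset_isCompact hK hsub,
    (closure_minimal hsub hK.isClosed).trans hKΛ, fun x => ?_⟩
  rw [div_smul_const (hFs.differentiable (by simp) x), hFd]

/-- In a connected open set, small bumps at any two points differ by a divergence. -/
lemma exists_isDivOf_sub {Λ : Set (Space n)} (hΛ : IsOpen Λ) (hΛ' : IsPreconnected Λ)
    {a b : Space n} (ha : a ∈ Λ) (hb : b ∈ Λ) :
    ∃ ε > 0, ∀ h : Space n → ℝ, ContDiff ℝ ∞ h → HasCompactSupport h →
      tsupport h ⊆ Metric.ball 0 ε → IsDivOf Λ fun x => h (x - a) - h (x - b) := by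
  -- The relation between `a` and `b` holds locally and is symmetric and transitive, so it holds
  -- throughout a preconnected set; chaining takes the smaller radius.
  refine hΛ'.induction₂ (fun a b => ∃ ε > 0, ∀ h : Space n → ℝ, ContDiff ℝ ∞ h →
    HasCompactSupport h → tsupport h ⊆ Metric.ball 0 ε →
      IsDivOf Λ fun x => h (x - a) - h (x - b)) ?_ ?_ ?_ ha hb
  · intro x hx
    obtain ⟨r, hr, hball⟩ := Metric.isOpen_iff.1 hΛ x hx
    refine Filter.Eventually.filter_mono nhdsWithin_le_nhds ?_
    filter_upwards [Metric.ball_mem_nhds x (half_pos hr)] with y hy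
    refine ⟨r / 2, half_pos hr, fun h hs hc hsupp => ?_⟩
    have := isDivOf_segment (Λ := Λ) hs hc x (y - x) fun w hw t ht => hball ?_
    · simpa using this
    · have h1 : ‖w‖ < r / 2 := by simpa using hsupp hw
      have h2 : ‖y - x‖ < r / 2 := by simpa [dist_eq_norm] using hy
      have h3 : ‖t • (y - x)‖ ≤ ‖y - x‖ := by
        rw [norm_smul, Real.norm_of_nonneg ht.1]
        exact mul_le_of_le_one_left (norm_nonneg _) ht.2
      rw [Metric.mem_ball, dist_eq_norm]
      calc ‖w + (x + t • (y - x)) - x‖ = ‖w + t • (y - x)‖ := by congr 1; abel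
        _ ≤ ‖w‖ + ‖t • (y - x)‖ := norm_add_le _ _
        _ < r := by linarith
  · rintro x y z - - - ⟨ε, hε, h1⟩ ⟨δ, hδ, h2⟩
    refine ⟨min ε δ, lt_min hε hδ, fun h hs hc hsupp => ?_⟩
    have := (h1 h hs hc (hsupp.trans (Metric.ball_subset_ball (min_le_left _ _)))).add
      (h2 h hs hc (hsupp.trans (Metric.ball_subset_ball (min_le_right _ _))))
    simpa using this
  · rintro x y - - ⟨ε, hε, h1⟩
    refine ⟨ε, hε, fun h hs hc hsupp => ?_⟩
    simpa using (h1 h hs hc hsupp).neg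

end Transport

lemma exists_bump {n : ℕ} {ε : ℝ} (hε : 0 < ε) : ∃ b : Space n → ℝ, ContDiff ℝ ∞ b ∧
    HasCompactSupport b ∧ tsupport b ⊆ Metric.ball 0 ε ∧ 0 < ∫ x, b x := by
  let b : ContDiffBump (0 : Space n) := ⟨ε / 4, ε / 2, by positivity, by linarith⟩
  refine ⟨b, b.contDiff, b.hasCompactSupport, ?_, b.integral_pos⟩
  rw [b.tsupport_eq]
  exact Metric.closedBall_subset_ball (half_lt_self hε)

lemma tsum_sub_shift_eq_zero {B : ℤ → ℝ} (hB : Summable B) : ∑' k, (B k - B (k + -1)) = 0 := by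
  have hB' : Summable fun k : ℤ => B (k + -1) := (Equiv.addRight (-1 : ℤ)).summable_iff.2 hB
  rw [hB.tsum_sub hB', sub_eq_zero]
  exact ((Equiv.addRight (-1 : ℤ)).tsum_eq B).symm

/-! ### A solenoidal test field with nonzero flux -/

namespace Pipe

variable {n : ℕ} (P : Pipe n)

/-- The axial coordinate is an open continuous surjection `Λ → ℝ`, hence a quotient map, and its
fibres are the connected cross sections; such a map pulls connected sets back to connected sets. -/
lemma isPreconnected_carrier : IsPreconnected P.carrier := by
  let f : P.carrier → ℝ := fun x => (x : Space n) (Fin.last n)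
  have hproj : IsOpenMap (EuclideanSpace.proj (Fin.last n) : Space n →L[ℝ] ℝ) := by
    refine ContinuousLinearMap.isOpenMap _ fun z => ⟨z • axis n, by simp⟩
  have hopen : IsOpenMap f := hproj.comp P.isOpen.isOpenMap_subtype_val
  have hcont : Continuous f :=
    (EuclideanSpace.proj (Fin.last n) : Space n →L[ℝ] ℝ).continuous.comp continuous_subtype_val
  have hfib : ∀ z, IsConnected (f ⁻¹' {z}) := by
    intro z
    have h := P.section_connected z
    have himg : Subtype.val '' (f ⁻¹' {z}) = {x ∈ P.carrier | x (Fin.last n) = z} := by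
      ext x
      simp [f, and_comm]
    refine ⟨?_, ?_⟩
    · rw [← himg] at h
      exact h.nonempty.of_image
    · rw [← Topology.IsInducing.subtypeVal.isPreconnected_image, himg]
      exact h.isPreconnected
  have hsurj : Function.Surjective f := fun z => (hfib z).nonempty
  have := (hopen.isQuotientMap hcont hsurj).isCoinducing.isConnected_preimage_of_isClosed
    hfib isClosed_univ isConnected_univ
  rw [Set.preimage_univ] at this
  exact isPreconnected_iff_preconnectedSpace.2 ⟨this.isPreconnected⟩

lemma shift_mem_carrier {k : ℤ} {x : Space n} : shift P.L k x ∈ P.carrier ↔ x ∈ P.carrier :=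
  (eq_of_periodic (f := fun x => x ∈ P.carrier) (fun x => propext (P.periodic x)) k x).to_iff

lemma isSolenoidalTest_periodize {φ : Space n → Space n} (hs : ContDiff ℝ ∞ φ)
    (hc : HasCompactSupport φ) (hφ : tsupport φ ⊆ P.carrier)
    (hd : ∀ x, periodize P.L (div φ) x = 0) : P.IsSolenoidalTest (periodize P.L φ) where
  smooth := contDiff_periodize P.L_pos hc hs
  periodic := periodize_periodic
  support x hx := by
    obtain ⟨k, hk⟩ := tsupport_periodize P.L_pos hc hx
    exact P.shift_mem_carrier.1 (hφ hk)
  div_eq_zero x := by rw [div_periodize P.L_pos hc hs, hd]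

/-- There is a compactly supported field with nonzero mean axial component whose periodization
is a solenoidal test field. -/
lemma exists_test_flux_ne_zero : ∃ φ : Space n → Space n, ContDiff ℝ ∞ φ ∧
    HasCompactSupport φ ∧ tsupport φ ⊆ P.carrier ∧ P.IsSolenoidalTest (periodize P.L φ) ∧
    ∫ x, inner ℝ (φ x) (axis n) ≠ 0 := by
  obtain ⟨p, hp, -⟩ := (P.section_connected 0).nonempty
  have hp' : p + P.L • axis n ∈ P.carrier := (P.periodic p).2 hp
  obtain ⟨ε, hε, H⟩ := exists_isDivOf_sub P.isOpen P.isPreconnected_carrier hp hp'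
  obtain ⟨b, hbs, hb, hb', hpos⟩ := exists_bump hε (n := n)
  obtain ⟨φ, hs, hc, hsub, hd⟩ := H b hbs hb hb'
  have hcs : ∀ a : Space n, HasCompactSupport fun x => b (x - a) := fun a =>
    hb.comp_homeomorph (Homeomorph.subRight a)
  refine ⟨φ, hs, hc, hsub, P.isSolenoidalTest_periodize hs hc hsub fun x => ?_, ?_⟩
  -- The two bumps differ by one period, so the periodized divergence telescopes.
  · have h1 : ∀ k : ℤ, b (shift P.L k x - (p + P.L • axis n)) =
        b (shift P.L (k + (-1)) x - p) := by
      intro k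
      congr 1
      simp only [shift, Int.cast_add]
      push_cast
      module
    have hsum := summable_shift P.L_pos (hcs p) x
    simp only [periodize, hd, h1]
    exact tsum_sub_shift_eq_zero hsum
  -- With `e_z = ∇z`, the flux is `-∫ z div φ`: the mass `∫ b` multiplied by the axial displacement
  -- `L`.
  · let z : Space n →L[ℝ] ℝ := EuclideanSpace.proj (Fin.last n)
    have hz : ∀ x, inner ℝ (φ x) (axis n) = fderiv ℝ z x (φ x) := by
      intro x
      rw [ContinuousLinearMap.fderiv]
      simp [axis, z, EuclideanSpace.inner_single_right]
    have i1 : ∀ a : Space n, Integrable fun x => z x * b (x - a) := fun a =>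
      integrable_mul_of_hasCompactSupport z.continuous
        (hbs.continuous.comp (continuous_id.sub continuous_const)) (Or.inr (hcs a))
    have i2 : ∀ a : Space n, ∫ x, z x * b (x - a) = ∫ x, z (x + a) * b x := fun a => by
      rw [← integral_add_right_eq_self _ a]
      simp
    have hbi : Integrable b := hbs.continuous.integrable_of_hasCompactSupport hb
    have i3 : ∀ a : Space n, Integrable fun x => z (x + a) * b x := fun a =>
      integrable_mul_of_hasCompactSupport (z.continuous.comp (continuous_id.add continuous_const))
        hbs.continuous (Or.inr hb)
    simp only [hz]
    rw [integral_fderiv_apply_eq_neg_integral_mul_div z.contDiff hs (Or.inr hc)]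
    simp only [hd, mul_sub]
    rw [integral_sub (i1 _) (i1 _), i2, i2, ← integral_sub (i3 _) (i3 _)]
    have : ∀ x, z (x + p) * b x - z (x + (p + P.L • axis n)) * b x = -P.L * b x := by
      intro x
      simp [z]
      ring
    simp only [this]
    rw [integral_const_mul]
    have := mul_pos P.L_pos hpos
    rw [neg_mul, neg_neg]
    exact this.ne'

end Pipe

/-! ### Maximum principle on a periodic cylinder -/

section MaximumPrinciple

/-- A positive second derivative would make `x` a local minimum as well, so `g` would be locally
constant and the second derivative zero. -/
lemma deriv_deriv_nonpos_of_isLocalMax {g : ℝ → ℝ} {x : ℝ} (hg : Continuous g)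
    (h : IsLocalMax g x) : deriv (deriv g) x ≤ 0 := by
  by_contra! hpos
  have hmin := isLocalMin_of_deriv_deriv_pos hpos h.deriv_eq_zero hg.continuousAt
  have hconst : g =ᶠ[nhds x] fun _ => g x := by
    filter_upwards [h, hmin] with y h1 h2 using le_antisymm h1 h2
  have : deriv (deriv g) x = 0 := by
    rw [hconst.deriv.deriv_eq]
    simp
  exact hpos.ne' this

variable {n : ℕ}

/-- The directional derivative of a function. -/
def dirDeriv (v : Space n) (f : Space n → ℝ) : Space n → ℝ := fun x => fderiv ℝ f x v

lemma contDiff_dirDeriv {f : Space n → ℝ} (hf : ContDiff ℝ ∞ f) (v : Space n) :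
    ContDiff ℝ ∞ (dirDeriv v f) :=
  (hf.fderiv_right (m := ∞) (by simp)).clm_apply contDiff_const

lemma hasCompactSupport_dirDeriv {f : Space n → ℝ} (hf : HasCompactSupport f) (v : Space n) :
    HasCompactSupport (dirDeriv v f) :=
  hf.fderiv_apply ℝ v

lemma tsupport_dirDeriv (f : Space n → ℝ) (v : Space n) :
    tsupport (dirDeriv v f) ⊆ tsupport f :=
  tsupport_fderiv_apply_subset ℝ v

lemma dirDeriv_comm {f : Space n → ℝ} (hf : ContDiff ℝ ∞ f) (v w : Space n) :
    dirDeriv v (dirDeriv w f) = dirDeriv w (dirDeriv v f) := by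
  ext x
  have hd : DifferentiableAt ℝ (fderiv ℝ f) x :=
    (hf.fderiv_right (m := ∞) (by simp)).differentiable (by simp) x
  have h : ∀ u u' : Space n, dirDeriv u (dirDeriv u' f) x = fderiv ℝ (fderiv ℝ f) x u u' := by
    intro u u'
    have := (hd.hasFDerivAt.clm_apply (hasFDerivAt_const u' x)).fderiv
    change fderiv ℝ (fun y => fderiv ℝ f y u') x u = _
    rw [this]
    simp
  rw [h, h]
  exact (hf.contDiffAt.of_le ENat.LEInfty.out).isSymmSndFDerivAt (n := 2) (by simp) v w

lemma dirDeriv_add {f g : Space n → ℝ} (hf : ContDiff ℝ ∞ f) (hg : ContDiff ℝ ∞ g) (v : Space n) :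
    dirDeriv v (fun x => f x + g x) = fun x => dirDeriv v f x + dirDeriv v g x := by
  ext x
  simp only [dirDeriv]
  rw [fderiv_fun_add (hf.differentiable (by simp) x) (hg.differentiable (by simp) x)]
  rfl

lemma deriv_line {f : Space n → ℝ} (hf : ContDiff ℝ ∞ f) (x v : Space n) :
    deriv (fun t : ℝ => f (x + t • v)) = fun t => dirDeriv v f (x + t • v) := by
  ext t
  have h1 : HasDerivAt (fun t : ℝ => x + t • v) v t := by
    simpa using ((hasDerivAt_id t).smul_const v).const_add x
  exact ((hf.differentiable (by simp) (x + t • v)).hasFDerivAt.comp_hasDerivAt t h1).deriv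

lemma dirDeriv_dirDeriv_nonpos_of_isLocalMax {f : Space n → ℝ} (hf : ContDiff ℝ ∞ f)
    {x : Space n} (h : IsLocalMax f x) (v : Space n) : dirDeriv v (dirDeriv v f) x ≤ 0 := by
  have hline : Continuous fun t : ℝ => x + t • v := by fun_prop
  have h1 : IsLocalMax (fun t : ℝ => f (x + t • v)) 0 := by
    have : IsLocalMax f (x + (0 : ℝ) • v) := by simpa using h
    exact this.comp_continuous (g := fun t : ℝ => x + t • v) hline.continuousAt
  have h2 := deriv_deriv_nonpos_of_isLocalMax (hf.continuous.comp hline) h1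
  rw [Function.comp_def, deriv_line hf, deriv_line (contDiff_dirDeriv hf v)] at h2
  simpa using h2

lemma isCompact_cube (M : ℝ) : IsCompact {y : Space n | ∀ i, |y i| ≤ M} := by
  have h := (EuclideanSpace.equiv (Fin (n + 1)) ℝ).toHomeomorph.isCompact_preimage.2
    (isCompact_Icc (a := fun _ => -M) (b := fun _ => M))
  convert h using 1
  ext y
  simp [Pi.le_def, abs_le, forall_and]

/-- Maximum principle: a function harmonic on the whole space, periodic in the axial direction
and vanishing outside a bounded cylinder is nonpositive. -/
lemma nonpos_of_harmonic_periodic (hn : 1 ≤ n) {L : ℝ} (hL : 0 < L) {f : Space n → ℝ}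
    (hs : ContDiff ℝ ∞ f) (hp : ∀ x, f (x + L • axis n) = f x) {R : ℝ}
    (hR : ∀ x : Space n, ∀ i ≠ Fin.last n, R ≤ |x i| → f x = 0)
    (hΔ : ∀ x, ∑ i, dirDeriv (EuclideanSpace.single i 1)
      (dirDeriv (EuclideanSpace.single i 1) f) x = 0) (x : Space n) : f x ≤ 0 := by
  have h0 : (0 : Fin (n + 1)) ≠ Fin.last n := by
    intro h
    have := congrArg Fin.val h
    simp at this
    omega
  -- The cube of half-width `M` must reach the region where `f` vanishes and contain a full axial
  -- period.
  set M := max R L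
  have hML : L ≤ M := le_max_right _ _
  have hMR : R ≤ M := le_max_left _ _
  have key : ∀ ε > 0, f x ≤ 0 + ε * M ^ 2 := by
    intro ε hε
    by_cases hx : ∃ i ≠ Fin.last n, R ≤ |x i|
    · obtain ⟨i, hi, hxi⟩ := hx
      rw [hR x i hi hxi]
      positivity
    push Not at hx
    -- Adding `ε x₀²` makes the Laplacian equal to `2ε > 0`, which excludes an interior maximum;
    -- `x₀` is transverse, so periodicity survives.
    let q : Space n → ℝ := fun y => ε * (y 0) ^ 2
    have hq : ContDiff ℝ ∞ q := by fun_prop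
    let F : Space n → ℝ := fun y => f y + q y
    have hF : ContDiff ℝ ∞ F := hs.add hq
    have hqd : ∀ v, dirDeriv v q = fun y => (2 * ε * v 0) * y 0 := by
      intro v
      ext y
      have h1 : HasFDerivAt (fun y : Space n => y 0)
        (EuclideanSpace.proj 0 : Space n →L[ℝ] ℝ) y :=
        (EuclideanSpace.proj 0 : Space n →L[ℝ] ℝ).hasFDerivAt
      have h2 := (h1.pow 2).const_mul ε
      simp only [dirDeriv, q]
      rw [h2.fderiv]
      simp
      ring
    have hqdd : ∀ v y, dirDeriv v (dirDeriv v q) y = 2 * ε * (v 0) ^ 2 := by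
      intro v y
      rw [hqd]
      have h1 : HasFDerivAt (fun y : Space n => y 0)
        (EuclideanSpace.proj 0 : Space n →L[ℝ] ℝ) y :=
        (EuclideanSpace.proj 0 : Space n →L[ℝ] ℝ).hasFDerivAt
      have h2 := h1.const_mul (2 * ε * v 0)
      simp only [dirDeriv]
      rw [h2.fderiv]
      simp
      ring
    have hFdd : ∀ v y, dirDeriv v (dirDeriv v F) y =
        dirDeriv v (dirDeriv v f) y + 2 * ε * (v 0) ^ 2 := by
      intro v y
      rw [← hqdd v y, dirDeriv_add hs hq, dirDeriv_add (contDiff_dirDeriv hs v)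
        (contDiff_dirDeriv hq v)]
    have hFp : ∀ y, F (y + L • axis n) = F y := by
      intro y
      simp [F, q, hp, axis_of_ne h0]
    have hcyl : ∀ y : Space n, (∀ i ≠ Fin.last n, |y i| ≤ M) →
        ∃ k : ℤ, ∀ i, |shift L k y i| ≤ M := by
      intro y hy
      obtain ⟨k, hk⟩ := exists_mem_slab hL y
      refine ⟨-k, fun i => ?_⟩
      by_cases hi : i = Fin.last n
      · subst hi
        rw [shift_last, abs_le]
        have h1 := hk.1
        have h2 := hk.2
        push_cast
        constructor <;> linarith
      · rw [shift_of_ne _ _ hi]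
        exact hy i hi
    obtain ⟨k₀, hk₀⟩ := hcyl x fun i hi => (hx i hi).le.trans hMR
    obtain ⟨m, hm, hmax⟩ := (isCompact_cube (n := n) M).exists_isMaxOn ⟨_, hk₀⟩
      hF.continuous.continuousOn
    -- By periodicity the maximum over the cube is one over the whole cylinder, so the axial faces
    -- of the cube are harmless.
    have hmax' : ∀ y : Space n, (∀ i ≠ Fin.last n, |y i| ≤ M) → F y ≤ F m := by
      intro y hy
      obtain ⟨k, hk⟩ := hcyl y hy
      rw [← eq_of_periodic hFp k y]
      exact hmax hk
    have hxm : f x ≤ F m := by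
      refine le_trans ?_ (hmax' x fun i hi => (hx i hi).le.trans hMR)
      have : 0 ≤ q x := by positivity
      simp only [F]
      linarith
    by_cases hb : ∃ i ≠ Fin.last n, M ≤ |m i|
    · obtain ⟨i, hi, hmi⟩ := hb
      refine hxm.trans ?_
      simp only [F, q]
      rw [hR m i hi (hMR.trans hmi)]
      have : (m 0) ^ 2 ≤ M ^ 2 := sq_le_sq' (abs_le.1 (hm 0)).1 (abs_le.1 (hm 0)).2
      gcongr
    · exfalso
      push Not at hb
      have hloc : IsLocalMax F m := by
        have hev : ∀ i ≠ Fin.last n, ∀ᶠ y : Space n in nhds m, |y i| < M := by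
          intro i hi
          have hc : Continuous fun y : Space n => |y i| := by fun_prop
          exact hc.continuousAt.eventually_lt continuousAt_const (hb i hi)
        have hev' : ∀ᶠ y : Space n in nhds m, ∀ i, i ≠ Fin.last n → |y i| < M := by
          rw [Filter.eventually_all]
          intro i
          by_cases hi : i = Fin.last n
          · simp [hi]
          · simpa [hi] using hev i hi
        filter_upwards [hev'] with y hy
        exact hmax' y fun i hi => (hy i hi).le
      have hsum : ∑ i, dirDeriv (EuclideanSpace.single i 1)
          (dirDeriv (EuclideanSpace.single i 1) F) m ≤ 0 :=
        Finset.sum_nonpos fun i _ => dirDeriv_dirDeriv_nonpos_of_isLocalMax hF hloc _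
      simp only [hFdd] at hsum
      rw [Finset.sum_add_distrib, hΔ, zero_add, ← Finset.mul_sum] at hsum
      simp at hsum
      linarith
  by_contra! hfx
  have hpos : 0 < M := hL.trans_le hML
  -- This `ε` turns the bound into `f x ≤ f x / 2`.
  have := key (f x / (2 * M ^ 2)) (by positivity)
  have e : f x / (2 * M ^ 2) * M ^ 2 = f x / 2 := by field_simp
  linarith

end MaximumPrinciple

/-! ### Mollification and the Liouville-type theorem -/

section Mollification

open scoped Convolution

variable {n : ℕ}

/-- The mollification of a scalar function. -/
def mollify (g η : Space n → ℝ) : Space n → ℝ :=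
  g ⋆[ContinuousLinearMap.mul ℝ ℝ, volume] η

lemma mollify_apply (g η : Space n → ℝ) (x : Space n) :
    mollify g η x = ∫ y, g y * η (x - y) := rfl

lemma contDiff_mollify {g η : Space n → ℝ} (hg : LocallyIntegrable g) (hη : ContDiff ℝ ∞ η)
    (hc : HasCompactSupport η) : ContDiff ℝ ∞ (mollify g η) :=
  hc.contDiff_convolution_right (n := ⊤) _ hg hη

lemma dirDeriv_mollify {g η : Space n → ℝ} (hg : LocallyIntegrable g) (hη : ContDiff ℝ ∞ η)
    (hc : HasCompactSupport η) (v : Space n) :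
    dirDeriv v (mollify g η) = mollify g (dirDeriv v η) := by
  ext x
  have h := hc.hasFDerivAt_convolution_right (ContinuousLinearMap.mul ℝ ℝ) hg
    (hη.of_le (by simp)) x
  simp only [dirDeriv, mollify]
  rw [h.fderiv, convolution_precompR_apply (hf := hg) (hcg := hc.fderiv ℝ)
    (hg := hη.continuous_fderiv (by simp))]
  rfl

lemma mollify_periodic {g η : Space n → ℝ} {L : ℝ} (hg : ∀ x, g (x + L • axis n) = g x)
    (x : Space n) : mollify g η (x + L • axis n) = mollify g η x := by
  rw [mollify_apply, mollify_apply, ← integral_add_right_eq_self _ (L • axis n)]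
  simp [hg]

lemma mollify_eq_zero {g η : Space n → ℝ} {R r : ℝ}
    (hη : tsupport η ⊆ Metric.closedBall 0 r) {i : Fin (n + 1)}
    (hg : ∀ x : Space n, R ≤ |x i| → g x = 0)
    {x : Space n} (hx : R + r ≤ |x i|) : mollify g η x = 0 := by
  rw [mollify_apply]
  refine integral_eq_zero_of_ae (Filter.Eventually.of_forall fun y => ?_)
  by_cases h : η (x - y) = 0
  · simp [h]
  · have h1 : ‖x - y‖ ≤ r := by simpa using hη (subset_tsupport η h)
    have h2 : |x i - y i| ≤ ‖x - y‖ := by simpa using PiLp.norm_apply_le (x - y) i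
    have h3 : |x i| ≤ |x i - y i| + |y i| := by simpa using abs_add_le (x i - y i) (y i)
    simp [hg y (by linarith)]

lemma integrable_mul_comp_sub {g η : Space n → ℝ} (hg : LocallyIntegrable g) (hη : Continuous η)
    (hc : HasCompactSupport η) (x : Space n) : Integrable fun y => g y * η (x - y) := by
  have h1 : HasCompactSupport fun y => η (x - y) := hc.comp_homeomorph (Homeomorph.subLeft x)
  have := hg.integrable_smul_left_of_hasCompactSupport
    (hη.comp (continuous_const.sub continuous_id)) h1
  simpa [mul_comm] using this

/-- A locally integrable field on the whole space that is weakly divergence free and weakly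
curl free, periodic in the axial direction and supported in a bounded cylinder vanishes. -/
lemma ae_eq_zero_of_div_curl_free (hn : 1 ≤ n) {L : ℝ} (hL : 0 < L) {g : Space n → Space n}
    (hg : LocallyIntegrable g) (hp : ∀ x, g (x + L • axis n) = g x) {R : ℝ}
    (hR : ∀ x : Space n, ∀ i ≠ Fin.last n, R ≤ |x i| → g x = 0)
    (hdiv : ∀ ψ : Space n → ℝ, ContDiff ℝ ∞ ψ → HasCompactSupport ψ →
      ∫ x, fderiv ℝ ψ x (g x) = 0)
    (hcurl : ∀ ψ : Space n → ℝ, ContDiff ℝ ∞ ψ → HasCompactSupport ψ → ∀ i j,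
      ∫ x, g x j * fderiv ℝ ψ x (EuclideanSpace.single i 1) =
        ∫ x, g x i * fderiv ℝ ψ x (EuclideanSpace.single j 1)) :
    ∀ᵐ x, g x = 0 := by
  have hgi : ∀ i, LocallyIntegrable fun x => g x i := fun i x => by
    obtain ⟨s, hs, hs'⟩ := hg x
    exact ⟨s, hs, (EuclideanSpace.proj i : Space n →L[ℝ] ℝ).integrable_comp hs'⟩
  have hderiv : ∀ (η : Space n → ℝ) (x y v : Space n), ContDiff ℝ ∞ η →
      fderiv ℝ (fun y => η (x - y)) y v = -dirDeriv v η (x - y) := by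
    intro η x y v hη
    have h1 : HasFDerivAt (fun y : Space n => x - y) (-ContinuousLinearMap.id ℝ (Space n)) y :=
      (hasFDerivAt_id y).const_sub x
    have h2 := (hη.differentiable (by simp) (x - y)).hasFDerivAt.comp y h1
    have h3 : (η ∘ fun y : Space n => x - y) = fun y => η (x - y) := rfl
    rw [h3] at h2
    rw [h2.fderiv]
    simp [dirDeriv]
  have hcs : ∀ (η : Space n → ℝ) (x : Space n), HasCompactSupport η →
      HasCompactSupport fun y => η (x - y) := fun η x hc =>
    hc.comp_homeomorph (Homeomorph.subLeft x)
  have hsm : ∀ (η : Space n → ℝ) (x : Space n), ContDiff ℝ ∞ η →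
      ContDiff ℝ ∞ fun y => η (x - y) := fun η x hη => hη.comp (contDiff_const.sub contDiff_id)
  have hmc : ∀ (η : Space n → ℝ), ContDiff ℝ ∞ η → HasCompactSupport η → ∀ i j,
      mollify (fun x => g x j) (dirDeriv (EuclideanSpace.single i 1) η) =
        mollify (fun x => g x i) (dirDeriv (EuclideanSpace.single j 1) η) := by
    intro η hη hc i j
    ext x
    have := hcurl _ (hsm η x hη) (hcs η x hc) i j
    simp only [hderiv η x _ _ hη, mul_neg, integral_neg, neg_inj] at this
    exact this
  have hmd : ∀ (η : Space n → ℝ), ContDiff ℝ ∞ η → HasCompactSupport η → ∀ x,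
      ∑ i, mollify (fun x => g x i) (dirDeriv (EuclideanSpace.single i 1) η) x = 0 := by
    intro η hη hc x
    simp only [mollify_apply]
    rw [← integral_finsetSum _ fun i _ => integrable_mul_comp_sub (hgi i)
      (contDiff_dirDeriv hη _).continuous (hasCompactSupport_dirDeriv hc _) x]
    have := hdiv _ (hsm η x hη) (hcs η x hc)
    simp only [hderiv η x _ _ hη, integral_neg, neg_eq_zero] at this
    rw [← this]
    congr 1
    ext y
    simp only [dirDeriv]
    conv_rhs => rw [← sum_smul_single (g y), map_sum]
    simp
  have hzero : ∀ (η : Space n → ℝ), ContDiff ℝ ∞ η → HasCompactSupport η → ∀ j x,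
      mollify (fun x => g x j) η x ≤ 0 := by
    intro η hη hc j
    obtain ⟨r, hr⟩ := hc.isCompact.isBounded.subset_closedBall 0
    refine nonpos_of_harmonic_periodic hn hL (contDiff_mollify (hgi j) hη hc)
      (mollify_periodic fun x => by rw [hp]) (R := R + r)
      (fun x i hi hx => mollify_eq_zero hr (fun y hy => by simp [hR y i hi hy]) hx) fun x => ?_
    -- `Δ(gⱼ ⋆ η) = ∑ᵢ gⱼ ⋆ ∂ᵢ∂ᵢη = ∑ᵢ gᵢ ⋆ ∂ⱼ∂ᵢη`, by curl-freeness tested on `∂ᵢη`; this vanishes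
    -- by divergence-freeness tested on `∂ⱼη`.
    rw [← hmd _ (contDiff_dirDeriv hη (EuclideanSpace.single j 1))
      (hasCompactSupport_dirDeriv hc _) x]
    refine Finset.sum_congr rfl fun i _ => ?_
    rw [dirDeriv_mollify (hgi j) hη hc, dirDeriv_mollify (hgi j) (contDiff_dirDeriv hη _)
      (hasCompactSupport_dirDeriv hc _), hmc _ (contDiff_dirDeriv hη _)
      (hasCompactSupport_dirDeriv hc _), dirDeriv_comm hη]
  have hall : ∀ i, ∀ᵐ x, g x i = 0 := by
    intro i
    refine ae_eq_zero_of_integral_contDiff_smul_eq_zero (hgi i) fun ψ hψ hc => ?_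
    -- Mollifying with the reflection of `χ` and evaluating at `0` gives the integral against `χ`;
    -- applying this to `ψ` and `-ψ` gives equality.
    have hneg : ∀ χ : Space n → ℝ, ContDiff ℝ ∞ χ → HasCompactSupport χ →
        ∫ x, χ x • g x i ≤ 0 := by
      intro χ hχ hχc
      have := hzero (fun y => χ (0 - y)) (hsm χ 0 hχ) (hcs χ 0 hχc) i 0
      simpa [mollify_apply, mul_comm] using this
    refine le_antisymm (hneg ψ hψ hc) ?_
    have := hneg (fun x => -ψ x) hψ.neg hc.neg
    simpa [integral_neg] using this
  filter_upwards [ae_all_iff.2 hall] with x hx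
  ext i
  exact hx i

end Mollification

/-! ### Zero extension from the pipe and pairings over the cell -/

namespace Pipe

variable {n : ℕ} (P : Pipe n) {F : Type*} [NormedAddCommGroup F]

lemma measurableSet_cell : MeasurableSet P.cell := by
  have h : Measurable fun x : Space n => x (Fin.last n) := by fun_prop
  exact P.isOpen.measurableSet.inter
    ((measurableSet_lt measurable_const h).inter (measurableSet_lt h measurable_const))

lemma volume_hyperplane (c : ℝ) : volume {x : Space n | x (Fin.last n) = c} = 0 := by
  have h := (EuclideanSpace.volume_preserving_symm_measurableEquiv_toLp
    (Fin (n + 1))).measure_preimage_equiv {y : Fin (n + 1) → ℝ | y (Fin.last n) = c}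
  have h2 := Measure.pi_hyperplane (fun _ : Fin (n + 1) => (volume : Measure ℝ)) (Fin.last n) c
  rw [← volume_pi] at h2
  rw [h2] at h
  exact h

/-- The open cell is replaced by the half-open slab, whose translates tile space; only the null
hyperplane `z = L` is added. -/
lemma cellMeasure_eq :
    P.cellMeasure = (volume.restrict (slab n P.L 0)).restrict P.carrier := by
  rw [cellMeasure, Measure.restrict_restrict P.isOpen.measurableSet]
  refine Measure.restrict_congr_set ?_
  have h : ∀ᵐ x : Space n, ¬ x (Fin.last n) = P.L := by
    rw [ae_iff]
    simpa using volume_hyperplane (n := n) P.L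
  filter_upwards [h] with x hx
  simp only [cell, cellOf, slab, eq_iff_iff]
  change (x ∈ P.carrier ∧ _) ↔ x ∈ P.carrier ∧ _
  simp only [Set.mem_ofPred_eq, Int.cast_zero, zero_mul, zero_add, one_mul]
  exact and_congr_right fun _ => and_congr_right fun _ => ⟨le_of_lt, fun h => lt_of_le_of_ne h hx⟩

lemma integral_cellMeasure (f : Space n → ℝ) :
    ∫ x, f x ∂P.cellMeasure = ∫ x in slab n P.L 0, P.carrier.indicator f x := by
  rw [cellMeasure_eq, integral_indicator P.isOpen.measurableSet]

lemma indicator_periodic {U : Space n → F}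
    (hU : ∀ x ∈ P.carrier, U (x + P.L • axis n) = U x) (x : Space n) :
    P.carrier.indicator U (x + P.L • axis n) = P.carrier.indicator U x := by
  by_cases hx : x ∈ P.carrier
  · rw [Set.indicator_of_mem hx, Set.indicator_of_mem ((P.periodic x).2 hx), hU x hx]
  · rw [Set.indicator_of_notMem hx, Set.indicator_of_notMem fun h => hx ((P.periodic x).1 h)]

lemma locallyIntegrable_indicator {U : Space n → F}
    (hU : ∀ x ∈ P.carrier, U (x + P.L • axis n) = U x) (hi : MemLp U 2 P.cellMeasure) :
    LocallyIntegrable (P.carrier.indicator U) := by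
  refine locallyIntegrable_of_periodic P.L_pos (P.indicator_periodic hU) ?_
  rw [IntegrableOn, integrable_indicator_iff P.isOpen.measurableSet, IntegrableOn,
    ← cellMeasure_eq]
  exact hi.integrable (by norm_num)

/-- Outside a bounded cylinder there is no point of the pipe. -/
lemma exists_radius : ∃ R : ℝ, ∀ x ∈ P.carrier, ∀ i ≠ Fin.last n, |x i| < R := by
  obtain ⟨R, hR⟩ := P.cell_bounded.subset_ball 0
  refine ⟨R, fun x hx i hi => ?_⟩
  have key : ∀ y ∈ cellOf P.L P.carrier, |y i| < R := fun y hy => by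
    have h1 : ‖y‖ < R := by simpa using hR hy
    exact (PiLp.norm_apply_le y i).trans_lt h1
  obtain ⟨k, hk⟩ := exists_mem_slab P.L_pos x
  set y := shift P.L (-k) x with hy
  have hyc : y ∈ P.carrier := P.shift_mem_carrier.2 hx
  have hyi : y i = x i := shift_of_ne _ _ hi
  have hk1 := hk.1
  have hk2 := hk.2
  have hy1 : 0 < y (Fin.last n) := by
    rw [hy, shift_last]
    push_cast
    linarith
  have hy2 : y (Fin.last n) ≤ P.L := by
    rw [hy, shift_last]
    push_cast
    linarith
  -- The translate `y` may lie on `z = L`, outside the open cell. Lowering it slightly keeps it in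
  -- the open set `Λ`, enters the cell and preserves the transverse coordinates.
  have hc : Continuous fun t : ℝ => y - t • axis n := by fun_prop
  have h1 : ∀ᶠ t : ℝ in nhds 0, y - t • axis n ∈ P.carrier :=
    hc.continuousAt.eventually (P.isOpen.mem_nhds (by simpa using hyc))
  have h2 : ∀ᶠ t : ℝ in nhds 0, t < y (Fin.last n) := eventually_lt_nhds hy1
  obtain ⟨t, ⟨h1, h2⟩, ht⟩ := (((h1.and h2).filter_mono nhdsWithin_le_nhds).and
    (self_mem_nhdsWithin (s := Set.Ioi (0 : ℝ)))).exists
  have ht' : 0 < t := ht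
  have := key (y - t • axis n) ⟨h1, by simp; linarith, by simp; linarith⟩
  simpa [axis_of_ne hi, hyi] using this

lemma memLp_of_continuous {Φ : Space n → Space n} (hΦ : Continuous Φ) :
    MemLp Φ 2 P.cellMeasure := by
  obtain ⟨C, hC⟩ := (P.cell_bounded.isCompact_closure.image hΦ).isBounded.exists_norm_le
  refine MemLp.of_bound hΦ.aestronglyMeasurable C ?_
  refine (ae_restrict_iff' P.measurableSet_cell).2 (Filter.Eventually.of_forall fun x hx => ?_)
  exact hC _ (Set.mem_image_of_mem _ (subset_closure hx))

/-- The element of `L²` given by a continuous field. -/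
def ofContinuous {Φ : Space n → Space n} (hΦ : Continuous Φ) : P.L2 :=
  (P.memLp_of_continuous hΦ).toLp Φ

lemma continuous_periodize {φ : Space n → Space n} (hs : ContDiff ℝ ∞ φ)
    (hc : HasCompactSupport φ) : Continuous (periodize P.L φ) :=
  (contDiff_periodize P.L_pos hc hs).continuous

/-- The scalar product in `L²` with a periodization, as an integral over the whole space. -/
lemma inner_ofContinuous_periodize {φ : Space n → Space n} (hs : ContDiff ℝ ∞ φ)
    (hc : HasCompactSupport φ) {u : P.L2} {U : Space n → Space n}
    (hU : ∀ x ∈ P.carrier, U (x + P.L • axis n) = U x) (hu : u =ᵐ[P.cellMeasure] U) :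
    inner ℝ (P.ofContinuous (P.continuous_periodize hs hc)) u =
      ∫ x, inner ℝ (φ x) (P.carrier.indicator U x) := by
  have hi : MemLp U 2 P.cellMeasure := (memLp_congr_ae hu).1 (Lp.memLp u)
  have hli := P.locallyIntegrable_indicator hU hi
  have hint : Integrable fun x => inner ℝ (φ x) (P.carrier.indicator U x) := by
    have h1 : ∀ x, inner ℝ (φ x) (P.carrier.indicator U x) =
        ∑ i, φ x i * P.carrier.indicator U x i := by
      intro x
      simp [PiLp.inner_apply, mul_comm]
    simp only [h1]
    refine integrable_finsetSum _ fun i _ => ?_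
    have h2 : Integrable fun x => φ x i • P.carrier.indicator U x :=
      hli.integrable_smul_left_of_hasCompactSupport (by fun_prop)
        (hc.comp_left (g := fun v : Space n => v i) rfl)
    exact (EuclideanSpace.proj i : Space n →L[ℝ] ℝ).integrable_comp h2
  rw [integral_inner_eq_slab P.L_pos hc (P.indicator_periodic hU) hint, L2.inner_def]
  have h3 : ∫ x, inner ℝ (P.ofContinuous (P.continuous_periodize hs hc) x) (u x) ∂P.cellMeasure =
      ∫ x, inner ℝ (periodize P.L φ x) (U x) ∂P.cellMeasure := by
    refine integral_congr_ae ?_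
    filter_upwards [hu, (P.memLp_of_continuous (P.continuous_periodize hs hc)).coeFn_toLp]
      with x h1 h2
    rw [ofContinuous, h1, h2]
  rw [h3, integral_cellMeasure]
  congr 1
  ext x
  by_cases hx : x ∈ P.carrier <;> simp [hx]

/-! ### Properties of the Leray projection of `e_z` -/

lemma ofContinuous_mem_H {Φ : Space n → Space n} (hΦ : P.IsSolenoidalTest Φ) :
    P.ofContinuous hΦ.smooth.continuous ∈ P.H :=
  P.testSpace.le_topologicalClosure ⟨Φ, hΦ, MemLp.coeFn_toLp _⟩

lemma ez_ae_eq : P.ez =ᵐ[P.cellMeasure] fun _ => axis n := MemLp.coeFn_toLp _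

lemma inner_leray {u v : P.L2} (hv : v ∈ P.H) : inner ℝ v (P.leray u) = inner ℝ v u := by
  rw [leray, ← Submodule.inner_starProjection_left_eq_right,
    Submodule.starProjection_eq_self_iff.2 hv]

lemma inner_indicator_of_tsupport {φ : Space n → Space n} (hφ : tsupport φ ⊆ P.carrier)
    (U : Space n → Space n) (x : Space n) :
    inner ℝ (φ x) (P.carrier.indicator U x) = inner ℝ (φ x) (U x) := by
  by_cases hx : x ∈ P.carrier
  · simp [hx]
  · simp [image_eq_zero_of_notMem_tsupport fun h => hx (hφ h)]

/-- Pairing with the test field of nonzero flux returns that flux. -/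
lemma leray_ez_ne_zero : P.leray P.ez ≠ 0 := by
  intro h0
  obtain ⟨φ, hs, hc, hsub, htest, hne⟩ := P.exists_test_flux_ne_zero
  refine hne ?_
  have h1 := P.inner_leray (u := P.ez) (P.ofContinuous_mem_H htest)
  rw [h0, inner_zero_right, P.inner_ofContinuous_periodize hs hc (fun _ _ => rfl) P.ez_ae_eq] at h1
  simpa only [P.inner_indicator_of_tsupport hsub] using h1.symm

lemma integral_fderiv_apply_const {ψ : Space n → ℝ} (hs : ContDiff ℝ ∞ ψ)
    (hc : HasCompactSupport ψ) (v : Space n) : ∫ x, fderiv ℝ ψ x v = 0 := by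
  have := integral_fderiv_apply_eq_neg_integral_mul_div hs
    (contDiff_const (c := v)) (Or.inl hc)
  rw [this]
  simp [div]

/-- Elements of `ℍ` are weakly divergence free on the whole space when extended by zero. -/
lemma integral_fderiv_indicator_eq_zero {u : P.L2} (hu : u ∈ P.H) {U : Space n → Space n}
    (hU : ∀ x ∈ P.carrier, U (x + P.L • axis n) = U x) (hu' : u =ᵐ[P.cellMeasure] U)
    {ψ : Space n → ℝ} (hs : ContDiff ℝ ∞ ψ) (hc : HasCompactSupport ψ) :
    ∫ x, fderiv ℝ ψ x (P.carrier.indicator U x) = 0 := by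
  let φ : Space n → Space n := fun x => (InnerProductSpace.toDual ℝ (Space n)).symm (fderiv ℝ ψ x)
  have hφ : ∀ x v, inner ℝ (φ x) v = fderiv ℝ ψ x v := fun x v =>
    InnerProductSpace.toDual_symm_apply
  have hφs : ContDiff ℝ ∞ φ :=
    (InnerProductSpace.toDual ℝ (Space n)).symm.contDiff.comp
      (hs.fderiv_right (m := ∞) (by simp))
  have hφc : HasCompactSupport φ := (hc.fderiv ℝ).comp_left (map_zero _)
  have h1 := P.inner_ofContinuous_periodize hφs hφc hU hu'
  simp only [hφ] at h1
  rw [← h1]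
  -- Orthogonality to the periodized gradient holds on `𝒱` by parts and passes to the closure. As
  -- `ψ` need not vanish on `S`, this includes the zero normal component at the boundary.
  have h2 : P.H ≤ (ℝ ∙ P.ofContinuous (P.continuous_periodize hφs hφc))ᗮ := by
    refine Submodule.topologicalClosure_minimal _ ?_ (Submodule.isClosed_orthogonal _)
    rintro v ⟨θ, hθ, hv⟩
    rw [Submodule.mem_orthogonal_singleton_iff_inner_right,
      P.inner_ofContinuous_periodize hφs hφc (fun x _ => hθ.periodic x) hv]
    have h3 : P.carrier.indicator θ = θ :=
      Set.indicator_eq_self.2 ((subset_tsupport θ).trans hθ.support)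
    simp only [h3, hφ]
    rw [integral_fderiv_apply_eq_neg_integral_mul_div hs hθ.smooth (Or.inl hc)]
    simp [hθ.div_eq_zero]
  exact (Submodule.mem_orthogonal_singleton_iff_inner_right).1 (h2 hu)

/-- The field `ℙe_z` is weakly curl free in the pipe. -/
lemma integral_curl_leray_ez {U : Space n → Space n}
    (hU : ∀ x ∈ P.carrier, U (x + P.L • axis n) = U x)
    (hu : P.leray P.ez =ᵐ[P.cellMeasure] U) {ψ : Space n → ℝ} (hs : ContDiff ℝ ∞ ψ)
    (hc : HasCompactSupport ψ) (hψ : tsupport ψ ⊆ P.carrier) (i j : Fin (n + 1)) :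
    ∫ x, (P.carrier.indicator U x j * fderiv ℝ ψ x (EuclideanSpace.single i 1) -
      P.carrier.indicator U x i * fderiv ℝ ψ x (EuclideanSpace.single j 1)) = 0 := by
  let s : Fin (n + 1) → Space n := fun k => EuclideanSpace.single k 1
  -- An antisymmetric combination of derivatives, divergence free because second derivatives
  -- commute.
  let φ : Space n → Space n := fun x =>
    dirDeriv (s i) ψ x • s j + -(dirDeriv (s j) ψ x • s i)
  have hd : ∀ k, ContDiff ℝ ∞ (dirDeriv (s k) ψ) := fun k => contDiff_dirDeriv hs _
  have hφs : ContDiff ℝ ∞ φ :=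
    ((hd i).smul contDiff_const).add ((hd j).smul contDiff_const).neg
  have hsupp : Function.support φ ⊆ tsupport ψ := by
    intro x hx
    by_contra hxψ
    refine hx ?_
    have : ∀ k, dirDeriv (s k) ψ x = 0 := fun k =>
      image_eq_zero_of_notMem_tsupport fun h => hxψ (tsupport_dirDeriv ψ _ h)
    simp [φ, this]
  have hφt : tsupport φ ⊆ tsupport ψ := closure_minimal hsupp (isClosed_tsupport ψ)
  have hφc : HasCompactSupport φ := hc.of_isClosed_subset (isClosed_tsupport φ) hφt
  have hdiv : ∀ x, div φ x = 0 := by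
    intro x
    have e : ∀ k l, DifferentiableAt ℝ (fun y => dirDeriv (s k) ψ y • s l) x := fun k l =>
      ((hd k).smul contDiff_const).differentiable (by simp) x
    have hadd := div_add (e i j) (g := fun y => -(dirDeriv (s j) ψ y • s i)) (e j i).neg
    rw [hadd, div_fun_neg,
      div_smul_const ((hd i).differentiable (by simp) x),
      div_smul_const ((hd j).differentiable (by simp) x)]
    have := congrFun (dirDeriv_comm hs (s j) (s i)) x
    simp only [dirDeriv] at this ⊢
    linarith
  have htest := P.isSolenoidalTest_periodize hφs hφc (hφt.trans hψ) fun x => by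
    simp [periodize, hdiv]
  have h1 := P.inner_leray (u := P.ez) (P.ofContinuous_mem_H htest)
  rw [P.inner_ofContinuous_periodize hφs hφc hU hu,
    P.inner_ofContinuous_periodize hφs hφc (fun _ _ => rfl) P.ez_ae_eq] at h1
  simp only [P.inner_indicator_of_tsupport (hφt.trans hψ) (fun _ => axis n)] at h1
  have hin : ∀ x v, inner ℝ (φ x) v = v j * dirDeriv (s i) ψ x - v i * dirDeriv (s j) ψ x := by
    intro x v
    simp [φ, s, inner_add_left, inner_neg_left, inner_smul_left,
      EuclideanSpace.inner_single_left]
    ring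
  simp only [hin] at h1
  have hI : ∀ k, Integrable (dirDeriv (s k) ψ) := fun k =>
    (hd k).continuous.integrable_of_hasCompactSupport (hasCompactSupport_dirDeriv hc _)
  have hz : ∀ k, ∫ x, dirDeriv (s k) ψ x = 0 := fun k => integral_fderiv_apply_const hs hc _
  -- The right-hand side is the pairing of `φ` with the constant `e_z`, which vanishes since
  -- derivatives of `ψ` have integral zero.
  rw [integral_sub ((hI i).const_mul _) ((hI j).const_mul _), integral_const_mul,
    integral_const_mul, hz, hz] at h1
  simpa [dirDeriv, s] using h1

/-- The field `ℙe_z` has no representative in `H¹₀`. -/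
lemma leray_ez_notMem_H10 (hn : 1 ≤ n) : P.leray P.ez ∉ P.H10 := by
  rintro ⟨U, G, hH1, htr, hu⟩
  let s : Fin (n + 1) → Space n := fun k => EuclideanSpace.single k 1
  have hUl := P.locallyIntegrable_indicator hH1.periodic hH1.memLp
  have hGl := P.locallyIntegrable_indicator hH1.grad_periodic hH1.grad_memLp
  have hGij : ∀ i j, LocallyIntegrable fun x => P.carrier.indicator G x (s i) j := fun i j x => by
    obtain ⟨t, ht, ht'⟩ := hGl x
    exact ⟨t, ht, ((EuclideanSpace.proj j : Space n →L[ℝ] ℝ).comp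
      (ContinuousLinearMap.apply ℝ (Space n) (s i))).integrable_comp ht'⟩
  have hUi : ∀ j, LocallyIntegrable fun x => P.carrier.indicator U x j := fun j x => by
    obtain ⟨t, ht, ht'⟩ := hUl x
    exact ⟨t, ht, (EuclideanSpace.proj j : Space n →L[ℝ] ℝ).integrable_comp ht'⟩
  -- Zero trace, componentwise: the zero extension of `G` is the weak gradient of the zero extension
  -- of `U` on the whole space.
  have htr' : ∀ ψ : Space n → ℝ, ContDiff ℝ ∞ ψ → HasCompactSupport ψ → ∀ i j,
      ∫ x, P.carrier.indicator U x j * fderiv ℝ ψ x (s i) =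
        -∫ x, ψ x * P.carrier.indicator G x (s i) j := by
    intro ψ hs hc i j
    have h1 := htr ψ hs hc (s i)
    have e1 : ∀ x, P.carrier.indicator (fun x => fderiv ℝ ψ x (s i) • U x) x =
        fderiv ℝ ψ x (s i) • P.carrier.indicator U x := fun x => by
      by_cases hx : x ∈ P.carrier <;> simp [hx]
    have e2 : ∀ x, P.carrier.indicator (fun x => ψ x • G x (s i)) x =
        ψ x • P.carrier.indicator G x (s i) := fun x => by
      by_cases hx : x ∈ P.carrier <;> simp [hx]
    rw [← integral_indicator P.isOpen.measurableSet, ← integral_indicator P.isOpen.measurableSet]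
      at h1
    simp only [e1, e2] at h1
    have i1 : Integrable fun x => fderiv ℝ ψ x (s i) • P.carrier.indicator U x :=
      hUl.integrable_smul_left_of_hasCompactSupport (contDiff_dirDeriv hs (s i)).continuous
        (hasCompactSupport_dirDeriv hc (s i))
    have i2 : Integrable fun x => ψ x • P.carrier.indicator G x (s i) :=
      (ContinuousLinearMap.apply ℝ (Space n) (s i)).integrable_comp
        (hGl.integrable_smul_left_of_hasCompactSupport hs.continuous hc)
    have h2 := congrArg (EuclideanSpace.proj j : Space n →L[ℝ] ℝ) h1
    rw [map_neg, ← ContinuousLinearMap.integral_comp_comm _ i1,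
      ← ContinuousLinearMap.integral_comp_comm _ i2] at h2
    simpa [mul_comm] using h2
  -- Curl-freeness in `Λ` makes `G` symmetric almost everywhere there, and outside `Λ` its extension
  -- is zero; the symmetry is therefore global.
  have hsymm : ∀ i j, ∀ᵐ x, P.carrier.indicator G x (s i) j = P.carrier.indicator G x (s j) i := by
    intro i j
    have h1 := P.isOpen.ae_eq_zero_of_integral_contDiff_smul_eq_zero
      (f := fun x => P.carrier.indicator G x (s i) j - P.carrier.indicator G x (s j) i)
      (((hGij i j).sub (hGij j i)).locallyIntegrableOn _) fun ψ hs hc hψ => by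
        have h2 := P.integral_curl_leray_ez hH1.periodic hu hs hc hψ i j
        have iU : ∀ k l, Integrable fun x =>
            P.carrier.indicator U x k * fderiv ℝ ψ x (s l) := fun k l => by
          simpa [mul_comm, dirDeriv] using (hUi k).integrable_smul_left_of_hasCompactSupport
            (contDiff_dirDeriv hs (s l)).continuous (hasCompactSupport_dirDeriv hc (s l))
        have iG : ∀ k l, Integrable fun x => ψ x * P.carrier.indicator G x (s k) l := fun k l =>
          (hGij k l).integrable_smul_left_of_hasCompactSupport hs.continuous hc
        rw [integral_sub (iU j i) (iU i j), htr' ψ hs hc, htr' ψ hs hc] at h2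
        simp only [smul_eq_mul, mul_sub]
        rw [integral_sub (iG i j) (iG j i)]
        linarith
    filter_upwards [h1] with x hx
    by_cases hxc : x ∈ P.carrier
    · exact sub_eq_zero.1 (hx hxc)
    · simp [hxc]
  obtain ⟨R, hR⟩ := P.exists_radius
  have hzero := ae_eq_zero_of_div_curl_free hn P.L_pos hUl (P.indicator_periodic hH1.periodic)
    (R := R) (fun x i hi hx => Set.indicator_of_notMem
      (fun hxc => absurd (hR x hxc i hi) (not_lt.2 hx)) _)
    (fun ψ hs hc => P.integral_fderiv_indicator_eq_zero (Submodule.starProjection_apply_mem _ _)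
      hH1.periodic hu hs hc)
    (fun ψ hs hc i j => by
      rw [htr' ψ hs hc i j, htr' ψ hs hc j i]
      congr 1
      refine integral_congr_ae ?_
      filter_upwards [hsymm i j] with x hx
      rw [hx])
  refine P.leray_ez_ne_zero ?_
  refine Lp.eq_zero_iff_ae_eq_zero.2 ?_
  have h1 : ∀ᵐ x ∂P.cellMeasure, P.carrier.indicator U x = 0 := ae_restrict_of_ae hzero
  have h2 : ∀ᵐ x ∂P.cellMeasure, x ∈ P.cell := ae_restrict_mem P.measurableSet_cell
  filter_upwards [hu, h1, h2] with x hx h1 h2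
  rw [hx, ← Set.indicator_of_mem h2.1 U, h1]
  rfl

lemma V_subset_H10 : P.V ⊆ P.H10 := fun _ ⟨U, G, h1, h2, h3, _⟩ => ⟨U, G, h1, h2, h3⟩

lemma smul_mem_H10 (c : ℝ) {u : P.L2} (hu : u ∈ P.H10) : c • u ∈ P.H10 := by
  obtain ⟨U, G, h1, h2, h3⟩ := hu
  have key : ∀ (ψ : Space n → ℝ) (w : Space n),
      ((∫ x in P.carrier, (fderiv ℝ ψ x w) • U x) = -(∫ x in P.carrier, ψ x • G x w)) →
      (∫ x in P.carrier, (fderiv ℝ ψ x w) • (c • U) x) =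
        -(∫ x in P.carrier, ψ x • (c • G) x w) := by
    intro ψ w h
    simp only [Pi.smul_apply, smul_apply, smul_comm _ c]
    rw [integral_smul, integral_smul, h, smul_neg]
  refine ⟨c • U, c • G, ⟨fun x hx => ?_, fun x hx => ?_, h1.memLp.const_smul c,
    h1.grad_memLp.const_smul c, fun ψ hs hc hψ w => key ψ w (h1.weak_grad ψ hs hc hψ w)⟩,
    fun ψ hs hc w => key ψ w (h2 ψ hs hc w), (Lp.coeFn_smul c u).trans (h3.const_smul c)⟩
  · simp [h1.periodic x hx]
  · simp [h1.grad_periodic x hx]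

end Pipe

end

theorem proposition4 (n : ℕ) (hn : 1 ≤ n) (P : Pipe n) :
    (P.leray P.ez ≠ 0 ∧ P.leray P.ez ∉ P.V ∧ P.leray P.ez ∉ P.H10) ∧
      (P.e ≠ 0 ∧ P.e ∉ P.V ∧ P.e ∉ P.H10) := by
  have h0 := P.leray_ez_ne_zero
  have h1 := P.leray_ez_notMem_H10 hn
  have hnorm : ‖P.leray P.ez‖ ≠ 0 := norm_ne_zero_iff.2 h0
  have h2 : P.e ∉ P.H10 := fun h => h1 <| by
    have := P.smul_mem_H10 ‖P.leray P.ez‖ h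
    rwa [Pipe.e, smul_smul, mul_inv_cancel₀ hnorm, one_smul] at this
  exact ⟨⟨h0, fun h => h1 (P.V_subset_H10 h), h1⟩,
    smul_ne_zero (inv_ne_zero hnorm) h0, fun h => h2 (P.V_subset_H10 h), h2⟩
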